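/- Let $E$ be a real Banach space that is uniformly smooth, i.e. the limit $\lim_{t\to0}\frac{\|x+ty\|-\|x\|}{t}$ exists uniformly for $x,y$ in the unit sphere of $E$. Let $D\subseteq E$ be nonempty, closed and convex, and let $T:D\to D$ be nonexpansive ($\|Tx-Ty\|\le\|x-y\|$) with fixed point set $F(T)\neq\emptyset$. Let $\Pi_D$ be the set of all contractions on $D$, i.e. of all $h:D\to D$ for which there is $a\in(0,1)$ with $\|h(x)-h(y)\|\le a\|x-y\|$ for all $x,y\in D$. For $h\in\Pi_D$ and $t\in(0,1)$ let $x_t$ be the unique point of $D$ with $x_t=t\,h(x_t)+(1-t)Tx_t$, and let $Q(h):=\lim_{t\to0^+}x_t\in F(T)$ (strong limit); these points and this limit exist. Let $f\in\Pi_D$, and for $n\ge0$ let $f_n,g_n:D\to D$, $\alpha_n\in[0,1]$, $\beta_n\in(0,1]$ and $\delta_n\in\mathbb R$ be such that: 1. there is $L\in(0,1)$ with $\|f_n(x)-f_n(y)\|\le L\|x-y\|$ for all $x,y\in D$ and all $n$, and $f_n\to f$ uniformly on $D$; 2. there is a constant $M>0$ with $\beta_n\|g_n(x)-x\|\le\delta_n(\|x\|+M)$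 for all $x\in D$ and all $n$, and $\sum_{n=0}^\infty\delta_n<\infty$; 3. $\alpha_n\to0$ and $\sum_{n=0}^\infty\alpha_n=\infty$. Let $x_0\in D$ and, for $n\ge0$, $$x_{n+1}=\alpha_n f_n(x_n)+(1-\alpha_n)Ty_n,\qquad y_n=\beta_n g_n(x_n)+(1-\beta_n)Tx_n .$$ If $\{x_n\}$ is bounded and $\|Tx_n-x_n\|\to0$, then $\{x_n\}$ converges strongly to $Q(f)$. -/

import Mathlib

open Filter Topology Set

/-- A real normed space is uniformly smooth if the limit of `(‖x + t y‖ - ‖x‖) / t` as `t → 0`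
(`t ≠ 0`, from both sides) exists uniformly for `x` and `y` in the unit sphere. -/
def IsUniformlySmooth (E : Type*) [NormedAddCommGroup E] [NormedSpace ℝ E] : Prop :=
  ∃ ρ : E × E → ℝ,
    TendstoUniformlyOn (fun (t : ℝ) (p : E × E) => (‖p.1 + t • p.2‖ - ‖p.1‖) / t) ρ
      (𝓝[≠] (0 : ℝ)) (Metric.sphere (0 : E) 1 ×ˢ Metric.sphere (0 : E) 1)

section

variable {E : Type*} [NormedAddCommGroup E] {D : Set E}

/-- `T : D → D` is nonexpansive. -/
def IsNonexpansive (T : D → D) : Prop :=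
  ∀ x y : D, ‖(T x : E) - (T y : E)‖ ≤ ‖(x : E) - (y : E)‖

/-- `f : D → D` satisfies `‖f x - f y‖ ≤ a ‖x - y‖` on `D`. -/
def IsContractionWith (a : ℝ) (f : D → D) : Prop :=
  ∀ x y : D, ‖(f x : E) - (f y : E)‖ ≤ a * ‖(x : E) - (y : E)‖

/-- The class of all contractions on `D`. -/
def contractions (D : Set E) : Set (D → D) :=
  {f | ∃ a ∈ Ioo (0 : ℝ) 1, IsContractionWith a f}

variable [NormedSpace ℝ E]

/-- `z` solves the implicit viscosity equation `z = t f(z) + (1 - t) T z`. -/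
def IsViscosityPoint (T f : D → D) (t : ℝ) (z : D) : Prop :=
  (z : E) = t • (f z : E) + (1 - t) • (T z : E)

/-- `q = Q(f)`: for each `t ∈ (0, 1)` the equation `z = t f(z) + (1 - t) T z` has exactly one
solution `x_t` in `D`, and `x_t → q` in norm as `t → 0⁺`. -/
def IsViscosityLimit (T f : D → D) (q : D) : Prop :=
  (∀ t ∈ Ioo (0 : ℝ) 1, ∃! z : D, IsViscosityPoint T f t z) ∧
    ∀ z : ℝ → D, (∀ t ∈ Ioo (0 : ℝ) 1, IsViscosityPoint T f t (z t)) →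
      Tendsto (fun t => (z t : E)) (𝓝[>] (0 : ℝ)) (𝓝 (q : E))

/-- There is at most one `q` with `q = Q(f)`. -/
theorem IsViscosityLimit.unique {T f : D → D} {p q : D}
    (hp : IsViscosityLimit T f p) (hq : IsViscosityLimit T f q) : p = q := by
  classical
  have h : ∀ t : ℝ, ∃ z : D, t ∈ Ioo (0 : ℝ) 1 → IsViscosityPoint T f t z := fun t => by
    by_cases ht : t ∈ Ioo (0 : ℝ) 1
    · obtain ⟨z, hz, -⟩ := hp.1 t ht
      exact ⟨z, fun _ => hz⟩
    · exact ⟨p, fun h => absurd h ht⟩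
  choose z hz using h
  exact Subtype.ext (tendsto_nhds_unique (hp.2 z hz) (hq.2 z hz))

/-- The extended Ishikawa scheme, for all `n ≥ 0` and an arbitrary starting point `x 0` of `D`:
`x_{n+1} = α_n f_n(x_n) + (1 - α_n) T y_n` and `y_n = β_n g_n(x_n) + (1 - β_n) T x_n`. -/
def IsExtendedIshikawa (T : D → D) (f g : ℕ → D → D) (α β : ℕ → ℝ) (x y : ℕ → D) : Prop :=
  ∀ n : ℕ,
    (x (n + 1) : E) = α n • (f n (x n) : E) + (1 - α n) • (T (y n) : E) ∧
    (y n : E) = β n • (g n (x n) : E) + (1 - β n) • (T (x n) : E)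

end

/-! ### Uniform smoothness: two-sided norm estimate, reflexivity, weak limits -/

section Smooth

variable {E : Type*} [NormedAddCommGroup E] [NormedSpace ℝ E]

/-! Let `q = Q(f)` and let `g` be a functional of norm at most one that norms `x (n+1) - q`.
Applying `g` to the scheme bounds `‖x (n+1) - q‖` by `(1 - α n * (1 - L)) * ‖x n - q‖` plus `α n *
(‖fn n q - f q‖ + g (f q - q))` plus a summable error, so `tendsto_zero_of_recursive_le` finishes
once `g (f q - q)` is asymptotically at most zero.

That sign comes from comparing `x n` with a viscosity point `z` close to `q`: accretivity of `1 - T`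
and `T (x n) - x n → 0` control a functional norming `z - x n`. The information is passed to `q` as
a purely metric bound (`eventually_norm_sub_le_of_viscosityPoints`), and smoothness turns it back
into one on `g` (`eventually_apply_le`); continuity of the duality map is never needed.

For `Q(f)` itself, minimize over `D` the asymptotic distance to the viscosity points along an
ultrafilter. The minimizers form a bounded invariant convex set, which contains a fixed point `q`;
minimality is again the metric bound, so the points tend to `q` along the ultrafilter. Hence there
are viscosity points arbitrarily near `q`, and the comparison above upgrades this to a full limit.
Reflexivity and the fixed point property are both derived from the smoothness estimate. -/

/-- Adding the difference quotients at `τ` and `-τ` cancels the derivative `ρ`. The lower bound `c`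
keeps the rescaled step `τ = s * ‖b‖ / ‖a‖` small. -/
theorem IsUniformlySmooth.norm_add_add_norm_sub_le (hE : IsUniformlySmooth E) {ε c : ℝ}
    (hε : 0 < ε) (hc : 0 < c) (R : ℝ) :
    ∃ δ > 0, ∀ s, 0 < s → s ≤ δ → ∀ a b : E, c ≤ ‖a‖ → ‖b‖ ≤ R →
      ‖a + s • b‖ + ‖a - s • b‖ ≤ 2 * ‖a‖ + ε * s := by
  obtain ⟨ρ, hρ⟩ := hE
  have hR : 0 < |R| + 1 := by positivity
  rw [Metric.tendstoUniformlyOn_iff] at hρ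
  have h := hρ (ε / (2 * (|R| + 1))) (by positivity)
  rw [eventually_nhdsWithin_iff, Metric.eventually_nhds_iff] at h
  obtain ⟨d, hd, h⟩ := h
  refine ⟨d * c / (|R| + 1) / 2, by positivity, fun s hs hsd a b ha hb => ?_⟩
  have ha0 : 0 < ‖a‖ := hc.trans_le ha
  by_cases hb0 : b = 0
  · subst hb0
    have : 0 ≤ ε * s := by positivity
    simp only [smul_zero, add_zero, sub_zero]
    linarith
  have hb0' : 0 < ‖b‖ := norm_pos_iff.2 hb0
  set τ : ℝ := s * ‖b‖ / ‖a‖ with hτ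
  have hτ0 : 0 < τ := by positivity
  have hτd : τ < d := by
    rw [hτ, div_lt_iff₀ ha0]
    have h1 : s * ‖b‖ < s * (|R| + 1) :=
      mul_lt_mul_of_pos_left (by linarith [le_abs_self R]) hs
    have h2 : s * (|R| + 1) ≤ d * c / 2 := by
      calc s * (|R| + 1) ≤ d * c / (|R| + 1) / 2 * (|R| + 1) := by gcongr
        _ = d * c / 2 := by field_simp
    have h3 : d * c ≤ d * ‖a‖ := by gcongr
    nlinarith [mul_pos hd hc]
  set u : E := ‖a‖⁻¹ • a with hu
  set w : E := ‖b‖⁻¹ • b with hw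
  have hmem : (u, w) ∈ Metric.sphere (0 : E) 1 ×ˢ Metric.sphere (0 : E) 1 := by
    simp [hu, hw, norm_smul, ha0.ne', hb0'.ne']
  have hun : ‖u‖ = 1 := by simpa using hmem.1
  have h1 := h (y := τ) (by rwa [Real.dist_eq, sub_zero, abs_of_pos hτ0]) hτ0.ne' (u, w) hmem
  have h2 := h (y := -τ) (by rwa [Real.dist_eq, sub_zero, abs_neg, abs_of_pos hτ0])
    (neg_ne_zero.2 hτ0.ne') (u, w) hmem
  rw [Real.dist_eq, abs_sub_lt_iff] at h1 h2
  simp only [hun, neg_smul, div_neg] at h1 h2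
  have h3 : (‖u + τ • w‖ - 1) / τ + (‖u + -(τ • w)‖ - 1) / τ ≤ ε / (|R| + 1) := by
    have : ε / (|R| + 1) = 2 * (ε / (2 * (|R| + 1))) := by field_simp
    linarith [h1.2, h2.1]
  rw [← add_div, div_le_iff₀ hτ0] at h3
  have e1 : a = ‖a‖ • u := by rw [hu, smul_inv_smul₀ ha0.ne']
  have e2 : s • b = ‖a‖ • τ • w := by
    rw [hw, hτ, smul_smul, smul_smul]
    congr 1
    field_simp
  have e3 : ‖a + s • b‖ = ‖a‖ * ‖u + τ • w‖ := by
    have : a + s • b = ‖a‖ • (u + τ • w) := by rw [smul_add, ← e1, ← e2]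
    rw [this, norm_smul, norm_norm]
  have e4 : ‖a - s • b‖ = ‖a‖ * ‖u + -(τ • w)‖ := by
    have : a - s • b = ‖a‖ • (u + -(τ • w)) := by rw [smul_add, smul_neg, ← e1, ← e2, sub_eq_add_neg]
    rw [this, norm_smul, norm_norm]
  rw [e3, e4]
  have h4 : ‖a‖ * (ε / (|R| + 1) * τ) ≤ ε * s := by
    have : ‖a‖ * (ε / (|R| + 1) * τ) = ε * s * (‖b‖ / (|R| + 1)) := by
      rw [hτ]; field_simp
    rw [this]
    refine mul_le_of_le_one_right (by positivity) ?_
    rw [div_le_one hR]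
    linarith [le_abs_self R]
  nlinarith [mul_le_mul_of_nonneg_left h3 ha0.le]

theorem IsUniformlySmooth.norm_add_add_norm_sub_le_unitBall (hE : IsUniformlySmooth E) {ε : ℝ}
    (hε : 0 < ε) :
    ∃ δ > 0, ∀ s, 0 < s → s ≤ δ → ∀ a b : E, ‖a‖ ≤ 1 → ‖b‖ ≤ 1 →
      ‖a + s • b‖ + ‖a - s • b‖ ≤ 2 + ε * s := by
  obtain ⟨δ, hδ, h⟩ := hE.norm_add_add_norm_sub_le hε (by norm_num : (0 : ℝ) < 1 / 2) 1
  refine ⟨min δ (1 / 2), by positivity, fun s hs hsd a b ha hb => ?_⟩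
  have hs1 := hsd.trans (min_le_left _ _)
  have hs2 := hsd.trans (min_le_right _ _)
  rcases le_total (1 / 2) ‖a‖ with h' | h'
  · linarith [h s hs hs1 a b h' hb]
  · have h1 := norm_add_le a (s • b)
    have h2 := norm_sub_le a (s • b)
    rw [norm_smul, Real.norm_of_nonneg hs.le] at h1 h2
    nlinarith [mul_pos hε hs]

theorem exists_norm_le_one_lt_apply (f : StrongDual ℝ E) {r : ℝ} (hr : r < ‖f‖) :
    ∃ x : E, ‖x‖ ≤ 1 ∧ r < f x := by
  obtain ⟨x, hx, hfx⟩ := f.exists_lt_apply_of_lt_opNorm hr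
  rw [Real.norm_eq_abs] at hfx
  rcases abs_cases (f x) with ⟨h, -⟩ | ⟨h, -⟩
  · exact ⟨x, hx.le, h ▸ hfx⟩
  · exact ⟨-x, by rw [norm_neg]; exact hx.le, by rw [map_neg]; exact h ▸ hfx⟩

theorem LinearIsometry.exists_norm_eq_one_le_norm_sub [CompleteSpace E] {X : Type*}
    [NormedAddCommGroup X] [NormedSpace ℝ X] (J : E →ₗᵢ[ℝ] X) (hJ : ¬ Function.Surjective J)
    {r : ℝ} (hr : r < 1) : ∃ F : X, ‖F‖ = 1 ∧ ∀ x, r ≤ ‖F - J x‖ := by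
  have hcl : IsClosed ((LinearMap.range J.toLinearMap : Submodule ℝ X) : Set X) := by
    have : IsComplete (range J) := J.isometry.isUniformInducing.isComplete_range
    exact this.isClosed
  obtain ⟨F₀, hF₀, hdist⟩ := riesz_lemma hcl (by
    by_contra! h
    exact hJ fun F => h F) hr
  have hn : 0 < ‖F₀‖ := norm_pos_iff.2 fun h => hF₀ (h ▸ Submodule.zero_mem _)
  refine ⟨‖F₀‖⁻¹ • F₀, by simp [norm_smul, hn.ne'], fun x => ?_⟩
  have h := hdist (‖F₀‖ • J x) (Submodule.smul_mem _ _ ⟨x, rfl⟩)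
  have e : F₀ - ‖F₀‖ • J x = ‖F₀‖ • (‖F₀‖⁻¹ • F₀ - J x) := by
    rw [smul_sub, smul_inv_smul₀ hn.ne']
  rw [e, norm_smul, norm_norm, mul_comm] at h
  exact le_of_mul_le_mul_left h hn

theorem StrongDual.apply_le_norm {f : StrongDual ℝ E} (hf : ‖f‖ ≤ 1) (x : E) : f x ≤ ‖x‖ :=
  (le_abs_self _).trans ((f.le_of_opNorm_le hf _).trans_eq (one_mul _))

theorem exists_bidual_le_norm_sub [CompleteSpace E]
    (hsurj : ¬ Function.Surjective (NormedSpace.inclusionInDoubleDualLi (E := E) ℝ)) {r : ℝ}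
    (hr : r < 1) : ∃ F : StrongDual ℝ (StrongDual ℝ E), ‖F‖ = 1 ∧
      ∀ x, r ≤ ‖F - NormedSpace.inclusionInDoubleDualLi (E := E) ℝ x‖ :=
  LinearIsometry.exists_norm_eq_one_le_norm_sub (X := StrongDual ℝ (StrongDual ℝ E)) _ hsurj hr

/-- Uniformly smooth Banach spaces are reflexive. -/
theorem IsUniformlySmooth.surjective_inclusionInDoubleDual [CompleteSpace E]
    (hE : IsUniformlySmooth E) :
    Function.Surjective (NormedSpace.inclusionInDoubleDualLi (E := E) ℝ) := by
  by_contra hsurj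
  obtain ⟨δ, hδ, hsm⟩ := hE.norm_add_add_norm_sub_le_unitBall (by norm_num : (0 : ℝ) < 1 / 2)
  obtain ⟨t, ht0, ht1, htδ⟩ : ∃ t, 0 < t ∧ t ≤ 1 ∧ t ≤ δ :=
    ⟨min δ 1, by positivity, min_le_right _ _, min_le_left _ _⟩
  -- With `u` almost norming `f + g`, smoothness bounds `f (u + t • x) + g (u - t • x)` by `2 + t /
  -- 2`, whereas `F f + F g > 2 - 3 * η + t * g x`. The terms `t * g x` cancel, leaving `t / 2 < 5 *
  -- η`, which fails for this `η`.
  obtain ⟨η, hη⟩ : ∃ η, η = t / 20 := ⟨_, rfl⟩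
  obtain ⟨F, hF1, hFd⟩ := exists_bidual_le_norm_sub hsurj (show 1 - η < 1 by linarith)
  obtain ⟨f, hf, hFf⟩ := exists_norm_le_one_lt_apply F (show 1 - η < ‖F‖ by linarith)
  have hfn : 1 - η < ‖f‖ := hFf.trans_le (by
    simpa [hF1] using (le_abs_self _).trans (F.le_opNorm f))
  obtain ⟨x, hx, hfx⟩ := exists_norm_le_one_lt_apply f hfn
  obtain ⟨g, hg, hFg⟩ := exists_norm_le_one_lt_apply _
    (lt_of_lt_of_le (by linarith) (hFd (t • x)) : 1 - 2 * η < _)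
  have hFg' : 1 - 2 * η < F g - t * g x := by
    have e : (NormedSpace.inclusionInDoubleDualLi (E := E) ℝ (t • x)) g = t * g x :=
      map_smul g t x
    rwa [← e]
  obtain ⟨u, hu, hfgu⟩ := exists_norm_le_one_lt_apply (f + g)
    (show ‖f + g‖ - η < ‖f + g‖ by linarith)
  have h1 : F f + F g ≤ ‖f + g‖ := by
    rw [← map_add]
    exact StrongDual.apply_le_norm hF1.le _
  have h2 := hsm t ht0 htδ u x hu hx
  have h3 := StrongDual.apply_le_norm hf (u + t • x)
  have h4 := StrongDual.apply_le_norm hg (u - t • x)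
  rw [map_add, map_smul, smul_eq_mul] at h3
  rw [map_sub, map_smul, smul_eq_mul] at h4
  rw [add_apply] at hfgu
  have h5 : t * (1 - η) ≤ t * f x := by gcongr
  have h6 : t * η ≤ η := mul_le_of_le_one_left (by linarith) ht1
  linarith

theorem exists_tendsto_of_bounded {ι : Type*} (U : Ultrafilter ι) {a : ι → ℝ} {R : ℝ}
    (h : ∀ i, |a i| ≤ R) : ∃ l, |l| ≤ R ∧ Tendsto a U (𝓝 l) := by
  have hc : IsCompact (Icc (-R) R) := isCompact_Icc
  obtain ⟨l, hl, hlim⟩ := hc.ultrafilter_le_nhds (U.map a) (by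
    rw [le_principal_iff]
    exact Eventually.of_forall (f := (U : Filter ι)) fun i => abs_le.1 (h i))
  exact ⟨l, abs_le.2 hl, hlim⟩

theorem IsUniformlySmooth.exists_weak_limit [CompleteSpace E] (hE : IsUniformlySmooth E)
    {ι : Type*} (U : Ultrafilter ι) {x : ι → E} {R : ℝ} (hx : ∀ i, ‖x i‖ ≤ R) :
    ∃ p : E, ∀ f : StrongDual ℝ E, Tendsto (fun i => f (x i)) U (𝓝 (f p)) := by
  have hb : ∀ (f : StrongDual ℝ E) i, |f (x i)| ≤ R * ‖f‖ := fun f i => by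
    have := f.le_opNorm (x i)
    rw [Real.norm_eq_abs] at this
    nlinarith [mul_le_mul_of_nonneg_left (hx i) (norm_nonneg f)]
  choose G hG hlim using fun f : StrongDual ℝ E => exists_tendsto_of_bounded U (hb f)
  let G' : StrongDual ℝ E →ₗ[ℝ] ℝ :=
    { toFun := G
      map_add' := fun f g => tendsto_nhds_unique (hlim (f + g)) ((hlim f).add (hlim g))
      map_smul' := fun c f => tendsto_nhds_unique (hlim (c • f)) ((hlim f).const_mul c) }
  obtain ⟨p, hp⟩ := hE.surjective_inclusionInDoubleDual (G'.mkContinuous R hG)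
  refine ⟨p, fun f => ?_⟩
  have : f p = G f := by
    exact congrArg (fun Φ : StrongDual ℝ (StrongDual ℝ E) => Φ f) hp
  exact this ▸ hlim f

theorem mem_of_weak_limit {ι : Type*} {l : Filter ι} [l.NeBot] {x : ι → E} {p : E}
    (hp : ∀ f : StrongDual ℝ E, Tendsto (fun i => f (x i)) l (𝓝 (f p)))
    {C : Set E} (hC : Convex ℝ C) (hC' : IsClosed C) (hx : ∀ᶠ i in l, x i ∈ C) : p ∈ C := by
  by_contra h
  obtain ⟨f, u, hf, hu⟩ := geometric_hahn_banach_closed_point hC hC' h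
  exact absurd (le_of_tendsto (hp f) (hx.mono fun i hi => (hf _ hi).le)) (not_le.2 hu)

end Smooth

/-! ### Asymptotic distances and fixed points of nonexpansive maps -/

section FixedPoint

variable {E : Type*} [NormedAddCommGroup E] {D : Set E}

theorem asymptotic_distance_apply_le {ι : Type*} {U : Ultrafilter ι} {x : ι → D} {φ : E → ℝ}
    (hφ : ∀ z, Tendsto (fun i => ‖(x i : E) - z‖) U (𝓝 (φ z))) {T : D → D}
    (hT : IsNonexpansive T)
    (hx : Tendsto (fun i => ‖(T (x i) : E) - x i‖) U (𝓝 0)) (z : D) : φ (T z) ≤ φ z := by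
  have h := (hφ z).add hx
  rw [add_zero] at h
  refine le_of_tendsto_of_tendsto' (hφ (T z)) h fun i => ?_
  have h1 := norm_sub_le_norm_sub_add_norm_sub (x i : E) (T (x i)) (T z)
  rw [norm_sub_rev (x i : E) (T (x i))] at h1
  linarith [hT (x i) z]

/-- The restriction of a self-map of `D` to an invariant subset. -/
def restrictSelfMap (T : D → D) (A : Set E) (hA : A ⊆ D)
    (hTA : ∀ z : D, (z : E) ∈ A → (T z : E) ∈ A) : A → A :=
  fun z => ⟨T ⟨z, hA z.2⟩, hTA _ z.2⟩

theorem IsNonexpansive.restrictSelfMap {T : D → D} (hT : IsNonexpansive T) {A : Set E}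
    (hA : A ⊆ D) (hTA : ∀ z : D, (z : E) ∈ A → (T z : E) ∈ A) :
    IsNonexpansive (restrictSelfMap T A hA hTA) :=
  fun x y => hT ⟨x, hA x.2⟩ ⟨y, hA y.2⟩

variable [NormedSpace ℝ E]

theorem existsUnique_isViscosityPoint [CompleteSpace E] (hne : D.Nonempty) (hcl : IsClosed D)
    (hconv : Convex ℝ D) {T f : D → D} (hT : IsNonexpansive T) (hf : f ∈ contractions D)
    {t : ℝ} (ht : t ∈ Ioo (0 : ℝ) 1) : ∃! z : D, IsViscosityPoint T f t z := by
  obtain ⟨a, ⟨ha0, ha1⟩, hfa⟩ := hf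
  obtain ⟨ht0, ht1⟩ := ht
  have : CompleteSpace D := hcl.completeSpace_coe
  have : Nonempty D := hne.to_subtype
  have hmem : ∀ z : D, t • (f z : E) + (1 - t) • (T z : E) ∈ D := fun z =>
    hconv (f z).2 (T z).2 ht0.le (by linarith) (by ring)
  let S : D → D := fun z => ⟨t • (f z : E) + (1 - t) • (T z : E), hmem z⟩
  have hk0 : 0 ≤ t * a + (1 - t) := by nlinarith
  have hS : ContractingWith ⟨t * a + (1 - t), hk0⟩ S := by
    refine ⟨?_, LipschitzWith.of_dist_le_mul fun x y => ?_⟩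
    · change t * a + (1 - t) < 1
      nlinarith
    · rw [Subtype.dist_eq, Subtype.dist_eq, dist_eq_norm, dist_eq_norm]
      have e : (S x : E) - S y = t • ((f x : E) - f y) + (1 - t) • ((T x : E) - T y) := by
        simp only [S]
        module
      rw [e]
      refine (norm_add_le _ _).trans ?_
      rw [norm_smul, norm_smul, Real.norm_of_nonneg ht0.le,
        Real.norm_of_nonneg (by linarith : (0 : ℝ) ≤ 1 - t)]
      have h1 := mul_le_mul_of_nonneg_left (hfa x y) ht0.le
      have h2 := mul_le_mul_of_nonneg_left (hT x y) (by linarith : (0 : ℝ) ≤ 1 - t)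
      refine (add_le_add h1 h2).trans_eq ?_
      change _ = (t * a + (1 - t)) * _
      ring
  have hiff : ∀ z : D, IsViscosityPoint T f t z ↔ Function.IsFixedPt S z := fun z =>
    ⟨fun h => Subtype.ext h.symm, fun h => (congrArg Subtype.val h).symm⟩
  refine ⟨hS.fixedPoint, (hiff _).2 hS.fixedPoint_isFixedPt, fun z hz => ?_⟩
  exact hS.fixedPoint_unique ((hiff z).1 hz)

theorem IsNonexpansive.exists_norm_sub_lt [CompleteSpace E] (hne : D.Nonempty) (hcl : IsClosed D)
    (hconv : Convex ℝ D) (hb : Bornology.IsBounded D) {T : D → D} (hT : IsNonexpansive T)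
    {ε : ℝ} (hε : 0 < ε) : ∃ z : D, ‖(T z : E) - z‖ < ε := by
  obtain ⟨c, hc⟩ := hne
  obtain ⟨R, hR⟩ := Metric.isBounded_iff.1 hb
  have hR0 : 0 ≤ R := dist_nonneg.trans (hR hc hc)
  have hcontr : (fun _ => ⟨c, hc⟩ : D → D) ∈ contractions D :=
    ⟨1 / 2, by norm_num, fun x y => by simp⟩
  set t : ℝ := min (1 / 2) (ε / (2 * (R + 1))) with ht
  have ht0 : 0 < t := by positivity
  have ht1 : t ≤ 1 / 2 := min_le_left _ _
  obtain ⟨z, hz, -⟩ := existsUnique_isViscosityPoint ⟨c, hc⟩ hcl hconv hT hcontr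
    (t := t) ⟨ht0, by linarith⟩
  refine ⟨z, ?_⟩
  have e : (T z : E) - z = t • ((T z : E) - c) := by
    conv_lhs => rw [hz]
    module
  rw [e, norm_smul, Real.norm_of_nonneg ht0.le]
  have h1 : ‖(T z : E) - c‖ ≤ R := by rw [← dist_eq_norm]; exact hR (T z).2 hc
  calc t * ‖(T z : E) - c‖ ≤ ε / (2 * (R + 1)) * (R + 1) := by
        gcongr
        · exact min_le_right _ _
        · linarith
    _ = ε / 2 := by field_simp
    _ < ε := by linarith

theorem exists_asymptotic_distance {ι : Type*} (U : Ultrafilter ι) {x : ι → E} {R : ℝ}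
    (hx : ∀ i, ‖x i‖ ≤ R) :
    ∃ φ : E → ℝ, (∀ z, Tendsto (fun i => ‖x i - z‖) U (𝓝 (φ z))) ∧
      LipschitzWith 1 φ ∧ ConvexOn ℝ univ φ ∧ ∀ z, 0 ≤ φ z := by
  have hb : ∀ z i, |‖x i - z‖| ≤ R + ‖z‖ := fun z i => by
    rw [abs_norm]
    exact (norm_sub_le _ _).trans (by linarith [hx i])
  choose φ _ hφ using fun z => exists_tendsto_of_bounded U (hb z)
  refine ⟨φ, hφ, LipschitzWith.of_le_add fun z w => ?_, ⟨convex_univ, ?_⟩, fun z => ?_⟩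
  · refine le_of_tendsto_of_tendsto' (hφ z) ((hφ w).add_const _) fun i => ?_
    rw [dist_comm, dist_eq_norm]
    exact norm_sub_le_norm_sub_add_norm_sub _ _ _
  · intro z _ w _ a b ha hb hab
    refine le_of_tendsto_of_tendsto' (hφ _) (((hφ z).const_mul a).add ((hφ w).const_mul b))
      fun i => ?_
    have e : x i - (a • z + b • w) = a • (x i - z) + b • (x i - w) := by
      rw [← sub_eq_zero]
      have : x i = (a + b) • x i := by rw [hab, one_smul]
      conv_lhs => enter [1, 1]; rw [this]
      module
    rw [e]
    refine (norm_add_le _ _).trans_eq ?_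
    rw [norm_smul, norm_smul, Real.norm_of_nonneg ha, Real.norm_of_nonneg hb]
  · exact ge_of_tendsto' (hφ z) fun i => norm_nonneg _

/-- Weak compactness: choose a point in each member and take a weak limit along an ultrafilter
running down the chain; closed convex sets are weakly closed. -/
theorem IsUniformlySmooth.nonempty_sInter_chain [CompleteSpace E] (hE : IsUniformlySmooth E)
    {c : Set (Set E)} (hc : IsChain (· ⊆ ·) c) (hc0 : c.Nonempty)
    (hcl : ∀ C ∈ c, IsClosed C) (hconv : ∀ C ∈ c, Convex ℝ C) (hne : ∀ C ∈ c, C.Nonempty)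
    {R : ℝ} (hR : ∀ C ∈ c, ∀ z ∈ C, ‖z‖ ≤ R) : (⋂₀ c).Nonempty := by
  have : Nonempty c := hc0.to_subtype
  choose x hx using fun C : c => hne C C.2
  have hdir : IsDirected c (· ≥ ·) := ⟨fun A B => by
    rcases hc.total A.2 B.2 with h | h
    · exact ⟨A, le_refl A, h⟩
    · exact ⟨B, h, le_refl B⟩⟩
  have hbot : (atBot : Filter c).NeBot := atBot_neBot
  obtain ⟨p, hp⟩ := hE.exists_weak_limit (Ultrafilter.of (atBot : Filter c))
    (x := x) fun C => hR C C.2 _ (hx C)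
  refine ⟨p, fun C hC => mem_of_weak_limit hp (hconv C hC) (hcl C hC) ?_⟩
  refine Ultrafilter.of_le _ ((eventually_le_atBot (⟨C, hC⟩ : c)).mono fun A hA => ?_)
  exact hA (hx A)

theorem exists_minimal_invariant [CompleteSpace E] (hE : IsUniformlySmooth E) (hne : D.Nonempty)
    (hcl : IsClosed D) (hconv : Convex ℝ D) (hb : Bornology.IsBounded D) (T : D → D) :
    ∃ A, Minimal (· ∈ {C : Set E | C ⊆ D ∧ IsClosed C ∧ Convex ℝ C ∧ C.Nonempty ∧
      ∀ z : D, (z : E) ∈ C → (T z : E) ∈ C}) A := by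
  obtain ⟨R, hR⟩ := hb.exists_norm_le
  obtain ⟨A, -, hA⟩ := zorn_superset_nonempty {C : Set E | C ⊆ D ∧ IsClosed C ∧ Convex ℝ C ∧
      C.Nonempty ∧ ∀ z : D, (z : E) ∈ C → (T z : E) ∈ C} (fun c hc hchain hc0 => by
    refine ⟨⋂₀ c, ⟨?_, ?_, ?_, ?_, ?_⟩, fun s hs => sInter_subset_of_mem hs⟩
    · obtain ⟨C, hC⟩ := hc0
      exact (sInter_subset_of_mem hC).trans (hc hC).1
    · exact isClosed_sInter fun C hC => (hc hC).2.1
    · exact convex_sInter fun C hC => (hc hC).2.2.1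
    · exact hE.nonempty_sInter_chain hchain hc0 (fun C hC => (hc hC).2.1)
        (fun C hC => (hc hC).2.2.1) (fun C hC => (hc hC).2.2.2.1)
        fun C hC z hz => hR z ((hc hC).1 hz)
    · exact fun z hz C hC => (hc hC).2.2.2.2 z (hz C hC)) D
    ⟨Subset.rfl, hcl, hconv, hne, fun z _ => (T z).2⟩
  exact ⟨A, hA⟩

/-- If the asymptotic distance of a bounded family is constant on a convex set containing the
family, then it vanishes there. -/
theorem IsUniformlySmooth.asymptotic_distance_eq_zero [CompleteSpace E]
    (hE : IsUniformlySmooth E) (hcl : IsClosed D) (hconv : Convex ℝ D)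
    {ι : Type*} (U : Ultrafilter ι) {x : ι → E} (hxD : ∀ i, x i ∈ D) {R : ℝ}
    (hR : ∀ i, ‖x i‖ ≤ R) {d : ℝ}
    (hd : ∀ z ∈ D, Tendsto (fun i => ‖x i - z‖) U (𝓝 d)) : d = 0 := by
  obtain ⟨p, hp⟩ := hE.exists_weak_limit U hR
  have hpD : p ∈ D := mem_of_weak_limit hp hconv hcl (Eventually.of_forall hxD)
  have hd0 : 0 ≤ d := ge_of_tendsto' (hd p hpD) fun i => norm_nonneg _
  by_contra hne
  have hdpos : 0 < d := lt_of_le_of_ne hd0 (Ne.symm hne)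
  obtain ⟨δ, hδ, hsm⟩ := hE.norm_add_add_norm_sub_le (half_pos hdpos) (half_pos hdpos)
    (R + ‖p‖)
  set s : ℝ := min δ 1 with hs
  have hs0 : 0 < s := by positivity
  have hs1 : s ≤ 1 := min_le_right _ _
  -- Smoothness at `a = x i - x n`, `b = x n - p`, with `n` running along `U`. Here `a - s • b` is
  -- `-(1 + s)` times `x n - w` with `w ∈ D`, and `‖a + s • b‖` is bounded below by a functional
  -- norming `x i - p`, as `x n - p` tends weakly to zero. Letting `i` run along `U` then gives `s *
  -- d ≤ s * d / 2`.
  have key : ∀ i, ‖x i - p‖ + (1 + s) * d ≤ 2 * d + d / 2 * s := by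
    intro i
    obtain ⟨g, hg, hgi⟩ := exists_dual_vector'' ℝ (x i - p)
    set w : E := p + (1 + s)⁻¹ • (x i - p) with hw
    have hwD : w ∈ D := by
      have := hconv hpD (hxD i) (a := 1 - (1 + s)⁻¹) (b := (1 + s)⁻¹)
        (sub_nonneg.2 (inv_le_one_of_one_le₀ (by linarith))) (by positivity) (by ring)
      convert this using 1
      rw [hw]
      module
    have hlim1 : Tendsto (fun n => ‖x i - p‖ - (1 - s) * (g (x n) - g p)) U (𝓝 ‖x i - p‖) := by
      have := (((hp g).sub_const (g p)).const_mul (1 - s)).const_sub ‖x i - p‖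
      simpa using this
    refine le_of_tendsto_of_tendsto (hlim1.add ((hd w hwD).const_mul (1 + s)))
      (((hd (x i) (hxD i)).const_mul 2).add_const (d / 2 * s)) ?_
    have hev : ∀ᶠ n in (U : Filter ι), d / 2 < ‖x n - x i‖ :=
      (hd (x i) (hxD i)).eventually (lt_mem_nhds (by linarith))
    filter_upwards [hev] with n hn
    rw [norm_sub_rev] at hn
    have h := hsm s hs0 (min_le_left _ _) (x i - x n) (x n - p) hn.le
      ((norm_sub_le _ _).trans (by linarith [hR n]))
    have e1 : ‖x i - p‖ - (1 - s) * (g (x n) - g p) ≤ ‖x i - x n + s • (x n - p)‖ := by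
      have h1 : g (x i - x n + s • (x n - p)) ≤ ‖x i - x n + s • (x n - p)‖ :=
        StrongDual.apply_le_norm hg _
      refine le_trans (le_of_eq ?_) h1
      have h2 : ‖x i - p‖ = g (x i - p) := hgi.symm
      rw [h2]
      simp only [map_add, map_sub, map_smul, smul_eq_mul]
      ring
    have e2 : ‖x i - x n - s • (x n - p)‖ = (1 + s) * ‖x n - w‖ := by
      have hpos : 0 < 1 + s := by linarith
      have : x i - x n - s • (x n - p) = (-(1 + s)) • (x n - w) := by
        have h3 : (1 + s) • (1 + s)⁻¹ • (x i - p) = x i - p := smul_inv_smul₀ hpos.ne' _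
        have h4 : (1 + s) • w = (1 + s) • p + (x i - p) := by rw [hw, smul_add, h3]
        rw [neg_smul, smul_sub (1 + s), h4]
        module
      rw [this, norm_smul, norm_neg, Real.norm_of_nonneg hpos.le]
    rw [e2] at h
    rw [norm_sub_rev (x n) (x i)]
    linarith
  have := le_of_tendsto' ((hd p hpD).add_const ((1 + s) * d)) key
  nlinarith [mul_pos hs0 hdpos]

/-- Nonexpansive self-maps of bounded closed convex sets in uniformly smooth spaces have fixed
points. -/
theorem IsNonexpansive.exists_fixedPoint [CompleteSpace E] (hE : IsUniformlySmooth E)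
    (hne : D.Nonempty) (hcl : IsClosed D) (hconv : Convex ℝ D) (hb : Bornology.IsBounded D)
    {T : D → D} (hT : IsNonexpansive T) : (Function.fixedPoints T).Nonempty := by
  obtain ⟨A, hA⟩ := exists_minimal_invariant hE hne hcl hconv hb T
  obtain ⟨hAD, hAcl, hAconv, hAne, hTA⟩ := hA.prop
  have hAb := hb.subset hAD
  obtain ⟨R, hR⟩ := hAb.exists_norm_le
  choose x hx using fun n : ℕ => (hT.restrictSelfMap hAD hTA).exists_norm_sub_lt hAne hAcl hAconv
    hAb (Nat.one_div_pos_of_nat (α := ℝ) (n := n))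
  let x' : ℕ → D := fun n => ⟨x n, hAD (x n).2⟩
  set U : Ultrafilter ℕ := hyperfilter ℕ
  have hU : (U : Filter ℕ) ≤ atTop := Nat.hyperfilter_le_atTop
  have hxT : Tendsto (fun n => ‖(T (x' n) : E) - x' n‖) U (𝓝 0) :=
    (squeeze_zero (fun n => norm_nonneg _) (fun n => (hx n).le)
      tendsto_one_div_add_atTop_nhds_zero_nat).mono_left hU
  obtain ⟨φ, hφ, hφl, hφc, hφ0⟩ := exists_asymptotic_distance U (x := fun n => (x n : E))
    fun n => hR _ (x n).2
  -- Sublevel sets of `φ` in `A` are invariant, so minimality of `A` makes `φ` constant there.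
  have hle : ∀ w ∈ A, ∀ z ∈ A, φ z ≤ φ w := by
    intro w hw z hz
    have hmem : A ∩ {z | φ z ≤ φ w} ∈ {C : Set E | C ⊆ D ∧ IsClosed C ∧ Convex ℝ C ∧
        C.Nonempty ∧ ∀ z : D, (z : E) ∈ C → (T z : E) ∈ C} := by
      refine ⟨inter_subset_left.trans hAD,
        hAcl.inter (isClosed_le hφl.continuous continuous_const), hAconv.inter ?_,
        ⟨w, hw, le_refl (φ w)⟩, fun z hz => ⟨hTA z hz.1, ?_⟩⟩
      · simpa using hφc.convex_le (φ w)
      · exact (asymptotic_distance_apply_le (x := x') hφ hT hxT z).trans hz.2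
    exact (hA.le_of_le hmem inter_subset_left hz).2
  obtain ⟨p, hp⟩ := hAne
  have hzero : φ p = 0 := hE.asymptotic_distance_eq_zero hAcl hAconv U (fun n => (x n).2)
    (fun n => hR _ (x n).2) fun z hz => by
      rw [le_antisymm (hle z hz p hp) (hle p hp z hz)]
      exact hφ z
  have hTp : φ (T ⟨p, hAD hp⟩) = 0 :=
    le_antisymm (hzero ▸ hle p hp _ (hTA ⟨p, hAD hp⟩ hp)) (hφ0 _)
  refine ⟨⟨p, hAD hp⟩, Subtype.ext ?_⟩
  have h1 := tendsto_iff_norm_sub_tendsto_zero.2 (hzero ▸ hφ p)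
  have h2 := tendsto_iff_norm_sub_tendsto_zero.2 (hTp ▸ hφ (T ⟨p, hAD hp⟩))
  exact tendsto_nhds_unique h2 h1

end FixedPoint

/-! ### A scalar recursion -/

/-- The positive part of `a n - ε / 4` contracts by `1 - γ n ≤ exp (-γ n)` up to `c n`. The `max` is
there because the functional estimate is available only while the iterate is at distance at least
`ε` from `q`. -/
theorem tendsto_zero_of_recursive_le {a γ c : ℕ → ℝ} (ha : ∀ n, 0 ≤ a n)
    (hγ : ∀ n, γ n ∈ Icc (0 : ℝ) 1)
    (hγs : Tendsto (fun N => ∑ n ∈ Finset.range N, γ n) atTop atTop)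
    (hc : ∀ n, 0 ≤ c n) (hcs : Summable c)
    (h : ∀ ε > 0, ∀ᶠ n in atTop, a (n + 1) ≤ max ε ((1 - γ n) * a n + γ n * ε + c n)) :
    Tendsto a atTop (𝓝 0) := by
  rw [Metric.tendsto_atTop]
  intro ε hε
  have hε4 : 0 < ε / 4 := by positivity
  obtain ⟨N₁, hN₁⟩ := eventually_atTop.1 (h (ε / 4) hε4)
  have htail := (tendsto_sum_nat_add c).eventually (gt_mem_nhds hε4)
  obtain ⟨N₂, hN₂⟩ := eventually_atTop.1 htail
  set N := max N₁ N₂ with hN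
  set b : ℕ → ℝ := fun n => max (a n - ε / 4) 0 with hb
  have hb0 : ∀ n, 0 ≤ b n := fun n => le_max_right _ _
  have hstep : ∀ n, N ≤ n → b (n + 1) ≤ (1 - γ n) * b n + c n := by
    intro n hn
    have h0 : 0 ≤ (1 - γ n) * b n + c n :=
      add_nonneg (mul_nonneg (sub_nonneg.2 (hγ n).2) (hb0 n)) (hc n)
    refine max_le ?_ h0
    rcases le_max_iff.1 (hN₁ n ((le_max_left _ _).trans hn)) with h1 | h1
    · linarith
    · have h2 : (1 - γ n) * (a n - ε / 4) ≤ (1 - γ n) * b n :=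
        mul_le_mul_of_nonneg_left (le_max_left _ _) (sub_nonneg.2 (hγ n).2)
      linarith
  have hiter : ∀ m, b (N + m) ≤ Real.exp (-∑ k ∈ Finset.range m, γ (k + N)) * b N +
      ∑ k ∈ Finset.range m, c (k + N) := by
    intro m
    induction m with
    | zero => simp
    | succ m ih =>
      have h1 := hstep (N + m) (Nat.le_add_right _ _)
      rw [Finset.sum_range_succ, Finset.sum_range_succ, neg_add, Real.exp_add, add_comm m N]
      have h2 : 1 - γ (N + m) ≤ Real.exp (-γ (N + m)) := Real.one_sub_le_exp_neg _
      have h3 := sub_nonneg.2 (hγ (N + m)).2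
      have h4 : (1 - γ (N + m)) * b (N + m) ≤ (1 - γ (N + m)) *
          (Real.exp (-∑ k ∈ Finset.range m, γ (k + N)) * b N +
            ∑ k ∈ Finset.range m, c (k + N)) := mul_le_mul_of_nonneg_left ih h3
      have h5 : (1 - γ (N + m)) * (Real.exp (-∑ k ∈ Finset.range m, γ (k + N)) * b N) ≤
          Real.exp (-γ (N + m)) * (Real.exp (-∑ k ∈ Finset.range m, γ (k + N)) * b N) :=
        mul_le_mul_of_nonneg_right h2 (mul_nonneg (Real.exp_pos _).le (hb0 N))
      have h6 : (1 - γ (N + m)) * ∑ k ∈ Finset.range m, c (k + N) ≤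
          ∑ k ∈ Finset.range m, c (k + N) :=
        mul_le_of_le_one_left (Finset.sum_nonneg fun k _ => hc _) (by linarith [(hγ (N + m)).1])
      rw [← add_assoc]
      linarith
  have hcsum : ∀ m, ∑ k ∈ Finset.range m, c (k + N) ≤ ε / 4 := fun m =>
    (((summable_nat_add_iff N).2 hcs).sum_le_tsum _ fun k _ => hc _).trans
      (hN₂ N (le_max_right _ _)).le
  have hγN : Tendsto (fun m => ∑ k ∈ Finset.range m, γ (k + N)) atTop atTop := by
    have h1 := (tendsto_add_atTop_iff_nat N).2 hγs
    have h2 := tendsto_atTop_add_const_right _ (-∑ k ∈ Finset.range N, γ k) h1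
    refine h2.congr fun m => ?_
    rw [add_comm m N, Finset.sum_range_add]
    simp only [add_comm N]
    ring
  have hexp : Tendsto (fun m => Real.exp (-∑ k ∈ Finset.range m, γ (k + N)) * b N) atTop
      (𝓝 0) := by
    simpa using (Real.tendsto_exp_neg_atTop_nhds_zero.comp hγN).mul_const (b N)
  obtain ⟨m₀, hm₀⟩ := eventually_atTop.1 (hexp.eventually (gt_mem_nhds hε4))
  refine ⟨N + m₀, fun n hn => ?_⟩
  obtain ⟨m, rfl⟩ := Nat.exists_eq_add_of_le ((Nat.le_add_right N m₀).trans hn)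
  have h1 := hiter m
  have h2 := hm₀ m (by omega)
  have h3 := hcsum m
  have h4 : a (N + m) - ε / 4 ≤ b (N + m) := le_max_left _ _
  rw [Real.dist_eq, sub_zero, abs_of_nonneg (ha _)]
  linarith

/-! ### Viscosity points and their strong limit -/

section Viscosity

variable {E : Type*} [NormedAddCommGroup E] {D : Set E}

theorem IsContractionWith.norm_sub_le {f : D → D} {a : ℝ} (ha : a < 1)
    (hf : IsContractionWith a f) (x y : D) : ‖(f x : E) - f y‖ ≤ ‖(x : E) - y‖ :=
  (hf x y).trans (mul_le_of_le_one_left (norm_nonneg _) ha.le)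

variable [NormedSpace ℝ E]

theorem IsUniformlySmooth.eventually_apply_le (hE : IsUniformlySmooth E) {ι : Type*}
    {l : Filter ι} {x : ι → E} {q v : E}
    (h : ∀ s, 0 < s → s ≤ 1 → ∀ ε > 0, ∀ᶠ i in l, ‖x i - q‖ - s * ε ≤ ‖x i - q - s • v‖)
    {ε : ℝ} (hε : 0 < ε) :
    ∀ᶠ i in l, ε ≤ ‖x i - q‖ → ∀ g : StrongDual ℝ E, ‖g‖ ≤ 1 → g (x i - q) = ‖x i - q‖ →
      g v ≤ ε := by
  obtain ⟨δ, hδ, hsm⟩ := hE.norm_add_add_norm_sub_le (half_pos hε) hε ‖v‖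
  set s := min δ 1 with hs
  have hs0 : 0 < s := by positivity
  filter_upwards [h s hs0 (min_le_right _ _) (ε / 2) (half_pos hε)] with i hi hεi g hg hgi
  have h1 := hsm s hs0 (min_le_left _ _) (x i - q) v hεi le_rfl
  have h2 := StrongDual.apply_le_norm hg (x i - q + s • v)
  rw [map_add, map_smul, smul_eq_mul, hgi] at h2
  have h3 : s * g v ≤ s * ε := by linarith
  exact le_of_mul_le_mul_left h3 hs0

/-- Accretivity of `1 - T`, with an error because `x` is only approximately fixed. -/
theorem IsViscosityPoint.apply_sub_le {T f : D → D} (hT : IsNonexpansive T) {t : ℝ}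
    (ht : t ∈ Ioo (0 : ℝ) 1) {z : D} (hz : IsViscosityPoint T f t z) (x : D)
    {g : StrongDual ℝ E} (hg : ‖g‖ ≤ 1) (hgz : g (z - x) = ‖(z : E) - x‖) :
    t * g ((z : E) - f z) ≤ ‖(T x : E) - x‖ := by
  obtain ⟨ht0, ht1⟩ := ht
  have e : (z : E) - x = t • ((f z : E) - z) + t • ((z : E) - x) + (1 - t) • ((T z : E) - x) := by
    conv_lhs => rw [hz]
    module
  have h1 := congrArg g e
  simp only [map_add, map_smul, smul_eq_mul, hgz] at h1
  have h2 : g ((T z : E) - x) ≤ ‖(z : E) - x‖ + ‖(T x : E) - x‖ := by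
    refine (StrongDual.apply_le_norm hg _).trans ?_
    have := norm_sub_le_norm_sub_add_norm_sub (T z : E) (T x) x
    linarith [hT z x]
  have h3 : (1 - t) * g ((T z : E) - x) ≤ (1 - t) * (‖(z : E) - x‖ + ‖(T x : E) - x‖) :=
    mul_le_mul_of_nonneg_left h2 (by linarith)
  have h4 : g ((z : E) - f z) = -g ((f z : E) - z) := by rw [← map_neg, neg_sub]
  have h5 := mul_nonneg ht0.le (norm_nonneg ((T x : E) - x))
  rw [h4]
  linarith

theorem eventually_norm_sub_le_of_viscosityPoints {T f : D → D} (hT : IsNonexpansive T) {a : ℝ}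
    (ha : a < 1) (hf : IsContractionWith a f) {q : D}
    (hq : ∀ η > 0, ∃ t ∈ Ioo (0 : ℝ) 1, ∃ z : D, IsViscosityPoint T f t z ∧ ‖(z : E) - q‖ < η)
    {ι : Type*} {l : Filter ι} {x : ι → D}
    (hx : Tendsto (fun i => ‖(T (x i) : E) - x i‖) l (𝓝 0)) {s : ℝ} (hs : 0 < s)
    {ε : ℝ} (hε : 0 < ε) :
    ∀ᶠ i in l, ‖(x i : E) - q‖ - s * ε ≤ ‖(x i : E) - q - s • ((f q : E) - q)‖ := by
  -- Replacing `z` by `q` costs `(2 + 2 * s) * ‖z - q‖`; the other half of `s * ε` pays for `T (x i)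
  -- - x i`, with `t` fixed before `i`.
  obtain ⟨t, ht, z, hz, hzq⟩ := hq (s * ε / 2 / (2 + 2 * s)) (by positivity)
  rw [lt_div_iff₀ (by positivity)] at hzq
  have ht0 := ht.1
  filter_upwards [hx.eventually (gt_mem_nhds (show 0 < t * (ε / 2) by positivity))] with i hi
  obtain ⟨g, hg, hgz⟩ := exists_dual_vector'' ℝ ((z : E) - x i)
  have h1 : g ((z : E) - f z) ≤ ε / 2 :=
    le_of_mul_le_mul_left ((hz.apply_sub_le hT ht (x i) hg hgz).trans hi.le) ht0
  have h2 := StrongDual.apply_le_norm hg ((z : E) - x i - s • ((z : E) - f z))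
  have hgz' : g ((z : E) - x i) = ‖(z : E) - x i‖ := hgz
  rw [map_sub _ _ (s • _), map_smul, smul_eq_mul, hgz'] at h2
  have h3 : s * g ((z : E) - f z) ≤ s * (ε / 2) := mul_le_mul_of_nonneg_left h1 hs.le
  have h4 : ‖(z : E) - x i - s • ((z : E) - f z)‖ ≤ ‖(x i : E) - q - s • ((f q : E) - q)‖ +
      (‖(z : E) - q‖ + s * (‖(z : E) - q‖ + ‖(z : E) - q‖)) := by
    have e : (z : E) - x i - s • ((z : E) - f z) = -((x i : E) - q - s • ((f q : E) - q)) +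
        (((z : E) - q) - s • (((z : E) - q) - ((f z : E) - f q))) := by module
    rw [e]
    refine (norm_add_le _ _).trans ?_
    rw [norm_neg]
    refine add_le_add_right ((_root_.norm_sub_le _ _).trans ?_) _
    rw [norm_smul, Real.norm_of_nonneg hs.le]
    gcongr
    exact (_root_.norm_sub_le _ _).trans (add_le_add_right (hf.norm_sub_le ha z q) _)
  have h5 : ‖(x i : E) - q‖ ≤ ‖(z : E) - x i‖ + ‖(z : E) - q‖ := by
    have := norm_sub_le_norm_sub_add_norm_sub (x i : E) z q
    rwa [norm_sub_rev (x i : E) z] at this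
  linarith

theorem IsViscosityPoint.norm_sub_le_add_apply {T f : D → D} (hT : IsNonexpansive T) {a : ℝ}
    (hf : IsContractionWith a f) {t : ℝ} (ht : t ∈ Ioo (0 : ℝ) 1) {z : D}
    (hz : IsViscosityPoint T f t z) {p : D} (hp : T p = p)
    {g : StrongDual ℝ E} (hg : ‖g‖ ≤ 1) (hgz : g (z - p) = ‖(z : E) - p‖) :
    ‖(z : E) - p‖ ≤ a * ‖(z : E) - p‖ + g ((f p : E) - p) := by
  have h1 := hz.apply_sub_le hT ht p hg hgz
  rw [hp, sub_self, norm_zero] at h1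
  have h2 : g ((z : E) - f z) ≤ 0 := by
    by_contra! h
    exact absurd h1 (not_le.2 (mul_pos ht.1 h))
  have h3 := (StrongDual.apply_le_norm hg ((f z : E) - f p)).trans (hf z p)
  have e : (z : E) - p = ((z : E) - f z) + ((f z : E) - f p) + ((f p : E) - p) := by abel
  have h4 := congrArg g e
  rw [hgz, map_add, map_add] at h4
  linarith

theorem IsViscosityPoint.norm_sub_le {T f : D → D} (hT : IsNonexpansive T) {a : ℝ} (ha : a < 1)
    (hf : IsContractionWith a f) {t : ℝ} (ht : t ∈ Ioo (0 : ℝ) 1) {z : D}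
    (hz : IsViscosityPoint T f t z) {p : D} (hp : T p = p) :
    ‖(z : E) - p‖ ≤ ‖(f p : E) - p‖ / (1 - a) := by
  obtain ⟨g, hg, hgz⟩ := exists_dual_vector'' ℝ ((z : E) - p)
  have h1 := hz.norm_sub_le_add_apply hT hf ht hp hg hgz
  have h2 := StrongDual.apply_le_norm hg ((f p : E) - p)
  rw [le_div_iff₀ (by linarith)]
  linarith

theorem IsViscosityPoint.norm_map_sub_le {T f : D → D} (hT : IsNonexpansive T) {a : ℝ}
    (ha : a < 1) (hf : IsContractionWith a f) {t : ℝ} (ht : t ∈ Ioo (0 : ℝ) 1) {z : D}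
    (hz : IsViscosityPoint T f t z) {p : D} (hp : T p = p) :
    ‖(T z : E) - z‖ ≤ t * (2 * (‖(f p : E) - p‖ / (1 - a)) + ‖(f p : E) - p‖) := by
  have e : (T z : E) - z = t • (((T z : E) - T p) - ((f z : E) - f p) - ((f p : E) - p)) := by
    rw [hp]
    conv_lhs => rw [hz]
    module
  rw [e, norm_smul, Real.norm_of_nonneg ht.1.le]
  refine mul_le_mul_of_nonneg_left ?_ ht.1.le
  refine (_root_.norm_sub_le _ _).trans (add_le_add_left ((_root_.norm_sub_le _ _).trans ?_) _)
  linarith [hT z p, hf.norm_sub_le ha z p, hz.norm_sub_le hT ha hf ht hp]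

theorem tendsto_norm_map_sub_of_viscosityPoints {T f : D → D} (hT : IsNonexpansive T)
    {a : ℝ} (ha : a < 1) (hf : IsContractionWith a f) {z : ℝ → D}
    (hz : ∀ t ∈ Ioo (0 : ℝ) 1, IsViscosityPoint T f t (z t)) {p : D} (hp : T p = p) :
    Tendsto (fun t => ‖(T (z t) : E) - z t‖) (𝓝[>] (0 : ℝ)) (𝓝 0) := by
  have hlim : Tendsto (fun t : ℝ => t * (2 * (‖(f p : E) - p‖ / (1 - a)) + ‖(f p : E) - p‖))
      (𝓝[>] (0 : ℝ)) (𝓝 0) := by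
    have : Tendsto (fun t : ℝ => t) (𝓝[>] (0 : ℝ)) (𝓝 0) := tendsto_nhdsWithin_of_tendsto_nhds
      tendsto_id
    simpa using this.mul_const (2 * (‖(f p : E) - p‖ / (1 - a)) + ‖(f p : E) - p‖)
  refine squeeze_zero' (Eventually.of_forall fun t => norm_nonneg _) ?_ hlim
  filter_upwards [Ioo_mem_nhdsGT one_pos] with t ht
  exact (hz t ht).norm_map_sub_le hT ha hf ht hp

theorem IsUniformlySmooth.tendsto_viscosityPoints (hE : IsUniformlySmooth E) {T f : D → D}
    (hT : IsNonexpansive T) {a : ℝ} (ha0 : 0 < a) (ha : a < 1) (hf : IsContractionWith a f)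
    {z : ℝ → D} (hz : ∀ t ∈ Ioo (0 : ℝ) 1, IsViscosityPoint T f t (z t)) {q : D} (hq : T q = q)
    {l : Filter ℝ} (hl : l ≤ 𝓝[>] (0 : ℝ))
    (h : ∀ s, 0 < s → s ≤ 1 → ∀ ε > 0, ∀ᶠ t in l,
      ‖(z t : E) - q‖ - s * ε ≤ ‖(z t : E) - q - s • ((f q : E) - q)‖) :
    Tendsto (fun t => (z t : E)) l (𝓝 (q : E)) := by
  rw [Metric.tendsto_nhds]
  intro ε hε
  have hpos : 0 < ε * (1 - a) / 2 := by
    have : 0 < 1 - a := by linarith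
    positivity
  filter_upwards [hE.eventually_apply_le h hpos, hl (Ioo_mem_nhdsGT one_pos)] with t h1 ht
  rw [dist_eq_norm]
  by_contra! hcon
  obtain ⟨g, hg, hgz⟩ := exists_dual_vector'' ℝ ((z t : E) - q)
  have h2 := h1 (by nlinarith) g hg hgz
  have h3 := (hz t ht).norm_sub_le_add_apply hT hf ht hq hg hgz
  nlinarith

/-- Coercivity and weak compactness make the set of minimizers nonempty and bounded; `hφT` makes it
invariant, so `T` has a fixed point in it. -/
theorem IsUniformlySmooth.exists_fixedPoint_minimizing [CompleteSpace E]
    (hE : IsUniformlySmooth E) (hne : D.Nonempty) (hcl : IsClosed D) (hconv : Convex ℝ D)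
    {T : D → D} (hT : IsNonexpansive T) {φ : E → ℝ} (hφl : LipschitzWith 1 φ)
    (hφc : ConvexOn ℝ univ φ) (hφ0 : ∀ z, 0 ≤ φ z) {R : ℝ} (hφR : ∀ z, ‖z‖ ≤ φ z + R)
    (hφT : ∀ z : D, φ (T z) ≤ φ z) :
    ∃ q : D, T q = q ∧ ∀ w ∈ D, φ q ≤ φ w := by
  set m := sInf (φ '' D) with hm
  have hbdd : BddBelow (φ '' D) := ⟨0, by rintro _ ⟨z, -, rfl⟩; exact hφ0 z⟩
  have hmle : ∀ w ∈ D, m ≤ φ w := fun w hw => csInf_le hbdd (mem_image_of_mem _ hw)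
  have hScl : ∀ r, IsClosed (D ∩ {z | φ z ≤ r}) := fun r =>
    hcl.inter (isClosed_le hφl.continuous continuous_const)
  have hSconv : ∀ r, Convex ℝ (D ∩ {z | φ z ≤ r}) := fun r =>
    hconv.inter (by simpa using hφc.convex_le r)
  obtain ⟨w, hw⟩ : (⋂₀ ((fun r => D ∩ {z | φ z ≤ r}) '' Ioc m (m + 1))).Nonempty := by
    refine hE.nonempty_sInter_chain (R := m + 1 + R) ?_ ?_ ?_ ?_ ?_ ?_
    · rintro _ ⟨r, -, rfl⟩ _ ⟨r', -, rfl⟩ -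
      rcases le_total r r' with h | h
      · exact Or.inl (inter_subset_inter_right _ fun z hz => le_trans hz h)
      · exact Or.inr (inter_subset_inter_right _ fun z hz => le_trans hz h)
    · exact ⟨_, mem_image_of_mem _ ⟨lt_add_one m, le_rfl⟩⟩
    · rintro _ ⟨r, -, rfl⟩
      exact hScl r
    · rintro _ ⟨r, -, rfl⟩
      exact hSconv r
    · rintro _ ⟨r, hr, rfl⟩
      obtain ⟨_, ⟨z, hz, rfl⟩, hzr⟩ := exists_lt_of_csInf_lt (hne.image φ) hr.1
      exact ⟨z, hz, hzr.le⟩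
    · rintro _ ⟨r, hr, rfl⟩ z hz
      have h1 : φ z ≤ r := hz.2
      linarith [hφR z, hr.2]
  have hw' : ∀ r ∈ Ioc m (m + 1), w ∈ D ∩ {z | φ z ≤ r} := fun r hr =>
    hw _ (mem_image_of_mem _ hr)
  have hwm : φ w ≤ m := le_of_forall_pos_le_add fun ε hε =>
    ((hw' (m + min ε 1) ⟨by simp [hε], by simp⟩).2 : φ w ≤ m + min ε 1).trans
      (by gcongr; exact min_le_left _ _)
  set K := D ∩ {z | φ z ≤ m} with hK
  have hKT : ∀ z : D, (z : E) ∈ K → (T z : E) ∈ K := fun z hz => ⟨(T z).2, (hφT z).trans hz.2⟩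
  have hKb : Bornology.IsBounded K := isBounded_iff_forall_norm_le.2
    ⟨m + R, fun z hz => (hφR z).trans (add_le_add_left hz.2 R)⟩
  have hwD : w ∈ D := (hw' (m + 1) ⟨lt_add_one m, le_rfl⟩).1
  have hKne : K.Nonempty := ⟨w, hwD, hwm⟩
  obtain ⟨q, hq⟩ := (hT.restrictSelfMap inter_subset_left hKT).exists_fixedPoint hE hKne (hScl m) (hSconv m) hKb
  have hqT : restrictSelfMap T K inter_subset_left hKT q = q := hq
  refine ⟨⟨q, q.2.1⟩, Subtype.ext ?_, fun w hw => le_trans q.2.2 (hmle w hw)⟩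
  exact congrArg (Subtype.val : K → E) hqT

/-- In a uniformly smooth Banach space the viscosity approximants of a nonexpansive map with a
fixed point converge strongly to a fixed point. -/
theorem IsUniformlySmooth.exists_isViscosityLimit [CompleteSpace E] (hE : IsUniformlySmooth E)
    (hcl : IsClosed D) (hconv : Convex ℝ D) {T : D → D} (hT : IsNonexpansive T)
    (hfix : (Function.fixedPoints T).Nonempty) {f : D → D} (hf : f ∈ contractions D) :
    ∃ q : D, T q = q ∧ IsViscosityLimit T f q ∧ ∀ η > 0, ∃ t ∈ Ioo (0 : ℝ) 1, ∃ z : D,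
      IsViscosityPoint T f t z ∧ ‖(z : E) - q‖ < η := by
  classical
  obtain ⟨p, hp⟩ := hfix
  have hne : D.Nonempty := ⟨p, p.2⟩
  have hex : ∀ t ∈ Ioo (0 : ℝ) 1, ∃! z : D, IsViscosityPoint T f t z := fun t ht =>
    existsUnique_isViscosityPoint hne hcl hconv hT hf ht
  obtain ⟨a, ⟨ha0, ha1⟩, hfa⟩ := hf
  set B := ‖(f p : E) - p‖ / (1 - a) with hB
  have hB0 : 0 ≤ B := div_nonneg (norm_nonneg _) (by linarith)
  -- The value `p` outside `(0, 1)` keeps the family bounded for every `t`, as the asymptotic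
  -- distance requires.
  have h : ∀ t : ℝ, ∃ z : D, ‖(z : E)‖ ≤ B + ‖(p : E)‖ ∧
      (t ∈ Ioo (0 : ℝ) 1 → IsViscosityPoint T f t z) := fun t => by
    by_cases ht : t ∈ Ioo (0 : ℝ) 1
    · obtain ⟨z, hz, -⟩ := hex t ht
      refine ⟨z, ?_, fun _ => hz⟩
      have h1 := hz.norm_sub_le hT ha1 hfa ht hp
      have h2 := norm_le_norm_sub_add (z : E) p
      linarith
    · exact ⟨p, by linarith, fun h => absurd h ht⟩
  choose z hzb hz using h
  have hzT := tendsto_norm_map_sub_of_viscosityPoints hT ha1 hfa hz hp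
  set U := Ultrafilter.of (𝓝[>] (0 : ℝ)) with hUdef
  have hU : (U : Filter ℝ) ≤ 𝓝[>] (0 : ℝ) := Ultrafilter.of_le _
  obtain ⟨φ, hφ, hφl, hφc, hφ0⟩ := exists_asymptotic_distance U (x := fun t => (z t : E)) hzb
  obtain ⟨q, hq, hqmin⟩ := hE.exists_fixedPoint_minimizing hne hcl hconv hT hφl hφc hφ0
    (R := B + ‖(p : E)‖) (fun w => by
      refine ge_of_tendsto' ((hφ w).add_const _) fun t => ?_
      have := norm_le_norm_sub_add w (z t)
      rw [norm_sub_rev] at this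
      linarith [hzb t]) (asymptotic_distance_apply_le hφ hT (hzT.mono_left hU))
  have hlimU : Tendsto (fun t => (z t : E)) U (𝓝 (q : E)) := by
    refine hE.tendsto_viscosityPoints hT ha0 ha1 hfa hz hq hU fun s hs0 hs1 ε hε => ?_
    have hmem : (q : E) + s • ((f q : E) - q) ∈ D :=
      hconv.add_smul_sub_mem q.2 (f q).2 ⟨hs0.le, hs1⟩
    have h1 := (hφ (q + s • ((f q : E) - q))).sub (hφ q)
    have h2 : -(s * ε) < φ (q + s • ((f q : E) - q)) - φ q := by
      have := hqmin _ hmem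
      have := mul_pos hs0 hε
      linarith
    filter_upwards [h1.eventually (lt_mem_nhds h2)] with t ht
    rw [← sub_sub] at ht
    linarith
  have hnear : ∀ η > 0, ∃ t ∈ Ioo (0 : ℝ) 1, ∃ z : D,
      IsViscosityPoint T f t z ∧ ‖(z : E) - q‖ < η := fun η hη => by
    have hev : ∀ᶠ t in (U : Filter ℝ), t ∈ Ioo (0 : ℝ) 1 := hU (Ioo_mem_nhdsGT one_pos)
    obtain ⟨t, ht, htη⟩ := (hev.and (Metric.tendsto_nhds.1 hlimU η hη)).exists
    exact ⟨t, ht, z t, hz t ht, by rwa [← dist_eq_norm]⟩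
  refine ⟨q, hq, ⟨hex, fun z' hz' => ?_⟩, hnear⟩
  refine hE.tendsto_viscosityPoints hT ha0 ha1 hfa hz' hq le_rfl fun s hs0 _ ε hε => ?_
  exact eventually_norm_sub_le_of_viscosityPoints hT ha1 hfa hnear
    (tendsto_norm_map_sub_of_viscosityPoints hT ha1 hfa hz' hp) hs0 hε

end Viscosity

/-! ### Convergence of the extended Ishikawa scheme -/

theorem theorem2p1 {E : Type*} [NormedAddCommGroup E] [NormedSpace ℝ E] [CompleteSpace E]
    (hE : IsUniformlySmooth E)
    (D : Set E) (hD_ne : D.Nonempty) (hD_closed : IsClosed D) (hD_convex : Convex ℝ D)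
    (T : D → D) (hT : IsNonexpansive T) (hT_fix : (Function.fixedPoints T).Nonempty)
    (f : D → D) (hf : f ∈ contractions D)
    (fn gn : ℕ → D → D)
    (L : ℝ) (hL : L ∈ Set.Ioo (0 : ℝ) 1) (hfn : ∀ n, IsContractionWith L (fn n))
    (hfn_lim : TendstoUniformly fn f atTop)
    (α β δ : ℕ → ℝ) (M : ℝ) (hM : 0 < M)
    (hα : ∀ n, α n ∈ Set.Icc (0 : ℝ) 1) (hβ : ∀ n, β n ∈ Set.Ioc (0 : ℝ) 1)
    (hgn : ∀ n, ∀ x : D, β n * ‖(gn n x : E) - (x : E)‖ ≤ δ n * (‖(x : E)‖ + M))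
    (hδ : Summable δ)
    (hα_lim : Tendsto α atTop (𝓝 0))
    (hα_sum : Tendsto (fun N => ∑ n ∈ Finset.range N, α n) atTop atTop)
    (x y : ℕ → D) (hxy : IsExtendedIshikawa T fn gn α β x y)
    (hx_bdd : Bornology.IsBounded (Set.range fun n => (x n : E)))
    (hx_reg : Tendsto (fun n => ‖(T (x n) : E) - (x n : E)‖) atTop (𝓝 0)) :
    ∃ q : D, q ∈ Function.fixedPoints T ∧ IsViscosityLimit T f q ∧
      Tendsto (fun n => (x n : E)) atTop (𝓝 (q : E)) := by
  obtain ⟨q, hq, hlim, hnear⟩ := hE.exists_isViscosityLimit hD_closed hD_convex hT hT_fix hf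
  refine ⟨q, hq, hlim, tendsto_iff_norm_sub_tendsto_zero.2 ?_⟩
  obtain ⟨a, ⟨ha0, ha1⟩, hfa⟩ := hf
  obtain ⟨hL0, hL1⟩ := hL
  obtain ⟨R, hR⟩ := isBounded_iff_forall_norm_le.1 hx_bdd
  have hxR : ∀ n, ‖(x n : E)‖ ≤ R := fun n => hR _ (mem_range_self n)
  have hR0 : 0 ≤ R := (norm_nonneg _).trans (hxR 0)
  -- Nonnegativity is not assumed; `hgn` at any point forces it.
  have hδ0 : ∀ n, 0 ≤ δ n := fun n => by
    have h1 := (mul_nonneg (hβ n).1.le (norm_nonneg _)).trans (hgn n q)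
    exact nonneg_of_mul_nonneg_left h1 (by positivity)
  have hy : ∀ n, ‖(T (y n) : E) - q‖ ≤ ‖(x n : E) - q‖ + δ n * (R + M) := fun n => by
    obtain ⟨hβ0, hβ1⟩ := hβ n
    have h1 : ‖(T (y n) : E) - q‖ ≤ ‖(y n : E) - q‖ := by simpa [hq] using hT (y n) q
    have h2 : ‖(T (x n) : E) - q‖ ≤ ‖(x n : E) - q‖ := by simpa [hq] using hT (x n) q
    have e : (y n : E) - q = β n • ((gn n (x n) : E) - x n) + (β n • ((x n : E) - q) +
        (1 - β n) • ((T (x n) : E) - q)) := by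
      rw [(hxy n).2]
      module
    have h3 : ‖(y n : E) - q‖ ≤ β n * ‖(gn n (x n) : E) - x n‖ + (β n * ‖(x n : E) - q‖ +
        (1 - β n) * ‖(T (x n) : E) - q‖) := by
      rw [e]
      refine (norm_add_le _ _).trans (add_le_add ?_ ((norm_add_le _ _).trans (add_le_add ?_ ?_)))
      · rw [norm_smul, Real.norm_of_nonneg hβ0.le]
      · rw [norm_smul, Real.norm_of_nonneg hβ0.le]
      · rw [norm_smul, Real.norm_of_nonneg (sub_nonneg.2 hβ1)]
    have h4 := mul_le_mul_of_nonneg_left h2 (sub_nonneg.2 hβ1)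
    have h5 : δ n * (‖(x n : E)‖ + M) ≤ δ n * (R + M) :=
      mul_le_mul_of_nonneg_left (by linarith [hxR n]) (hδ0 n)
    linarith [hgn n (x n)]
  have hsum : Tendsto (fun N => ∑ n ∈ Finset.range N, α n * (1 - L)) atTop atTop := by
    simp only [← Finset.sum_mul]
    exact hα_sum.atTop_mul_const (by linarith)
  refine tendsto_zero_of_recursive_le (γ := fun n => α n * (1 - L))
    (c := fun n => δ n * (R + M)) (fun n => norm_nonneg _)
    (fun n => ⟨mul_nonneg (hα n).1 (by linarith), ?_⟩) hsum
    (fun n => mul_nonneg (hδ0 n) (by positivity)) (hδ.mul_right _) fun ε hε => ?_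
  · exact mul_le_one₀ (hα n).2 (by linarith) (by linarith)
  -- Half is spent on `fn n q - f q`, half on `g (f q - q)`; together they give `γ n * ε`.
  have hε' : 0 < ε * (1 - L) / 2 := by
    have : 0 < 1 - L := by linarith
    positivity
  -- Shifted by one, since `g` norms `x (n + 1) - q`.
  have hev := (tendsto_add_atTop_nat 1).eventually (hE.eventually_apply_le
    (fun s hs0 _ ε hε => eventually_norm_sub_le_of_viscosityPoints hT ha1 hfa hnear hx_reg hs0 hε)
    hε')
  have hfq : ∀ᶠ n in atTop, ‖(fn n q : E) - f q‖ < ε * (1 - L) / 2 := by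
    filter_upwards [Metric.tendstoUniformly_iff.1 hfn_lim _ hε'] with n hn
    have := hn q
    rwa [Subtype.dist_eq, dist_comm, dist_eq_norm] at this
  filter_upwards [hev, hfq] with n hn hfn'
  rcases le_total ‖(x (n + 1) : E) - q‖ ε with hle | hle
  · exact le_max_of_le_left hle
  refine le_max_of_le_right ?_
  obtain ⟨hα0, hα1⟩ := hα n
  obtain ⟨g, hg, hgx⟩ := exists_dual_vector'' ℝ ((x (n + 1) : E) - q)
  have hgx' : g ((x (n + 1) : E) - q) = ‖(x (n + 1) : E) - q‖ := hgx
  have h1 := hn (by nlinarith) g hg hgx'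
  have e : (x (n + 1) : E) - q = α n • (((fn n (x n) : E) - fn n q) + ((fn n q : E) - f q) +
      ((f q : E) - q)) + (1 - α n) • ((T (y n) : E) - q) := by
    rw [(hxy n).1]
    module
  have h2 := congrArg g e
  rw [hgx'] at h2
  simp only [map_add, map_smul, smul_eq_mul] at h2
  have h3 := (StrongDual.apply_le_norm hg ((fn n (x n) : E) - fn n q)).trans (hfn n (x n) q)
  have h4 := StrongDual.apply_le_norm hg ((fn n q : E) - f q)
  have h5 := (StrongDual.apply_le_norm hg ((T (y n) : E) - q)).trans (hy n)
  have h6 := mul_le_mul_of_nonneg_left (add_le_add (add_le_add h3 (h4.trans hfn'.le)) h1) hα0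
  have h7 := mul_le_mul_of_nonneg_left h5 (sub_nonneg.2 hα1)
  have h8 : 0 ≤ α n * (δ n * (R + M)) :=
    mul_nonneg hα0 (mul_nonneg (hδ0 n) (by positivity))
  rw [h2]
  linarith
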